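/- Let $\mathbb K$ be a field of characteristic different from $2$. For $n\ge 1$ let $\mathfrak m_0(n)$ be the Lie algebra over $\mathbb K$ with basis $e_1,\dots,e_n$ and the only nonzero brackets of basis vectors $[e_1,e_i]=e_{i+1}=-[e_i,e_1]$, $2\le i\le n-1$; put $e_i=0$ for $i>n$, and let $e^1,\dots,e^n$ be the dual basis. A skew-symmetric bilinear map $\Psi:\mathfrak m_0(n)\times\mathfrak m_0(n)\to\mathfrak m_0(n)$ is said to satisfy the deformation equation if $d\Psi+\tfrac12[\Psi,\Psi]=0$, where $$d\Psi(x,y,z)=\sum_{\mathrm{cyc}}\bigl(\Psi([x,y],z)+[\Psi(x,y),z]\bigr),\qquad \tfrac12[\Psi,\Psi](x,y,z)=\sum_{\mathrm{cyc}}\Psi(\Psi(x,y),z)$$ (sums over the cyclic permutations of $x,y,z$; $[\Psi,\Psi]$ is the Nijenhuis–Richardson bracket); equivalently, $[\cdot,\cdot]+\Psi$ satisfies the Jacobi identity. For $j\ge 2$, $s\ge 0$ let $\Psi_{j,s}$ be the skew-symmetric bilinear map with $$\Psi_{j,s}(e_a,e_b)=(-1)^{j-a}\binom{b-j-1}{j-a}e_{a+b+s},\qquad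 2\le a\le j<b\le n,\quad a+b\ge 2j+1,$$ and $\Psi_{j,s}(e_a,e_b)=0$ for all other pairs $a<b$ (so $\Psi_{j,s}=0$ if $2j+1+s>n$); for $n=2k$ let $$\Psi_{k,-1}=\sum_{l=0}^{k-2}(-1)^l\,e_{2k}\otimes e^{k-l}\wedge e^{k+1+l}.$$ For a family $(x_{j,s})_{j\ge2,\,s\ge0}$ of elements of $\mathbb K$ and integers $2\le j<q$ put, for $r\ge 0$, $$\begin{aligned}F_{j,q,r}={}&\sum_{t=0}^r\sum_{l=j}^{\left[\frac{j+q-1}{2}\right]}\sum_{m=q+1}^{q+\left[\frac{j+t}{2}\right]}(-1)^{l-j+m-q}\binom{q-l-1}{l-j}\binom{j+q-m+t-1}{m-q-1}x_{l,t}x_{m,r-t}\\&+\sum_{t=0}^r\sum_{l=j}^{\left[\frac{j+q}{2}\right]}\sum_{m=q}^{q+\left[\frac{j+t}{2}\right]}(-1)^{l-j+m-q}\binom{q-l}{l-j}\binom{j+q-m+t}{m-q}x_{l,t}x_{m,r-t}\\&+\sum_{t=0}^r\sum_{m=j}^{q+\left[\frac{j+t}{2}\right]}(-1)^{m-j+1}\binom{2q-m+t}{m-j}x_{q,t}x_{m,r-t},\end{aligned}$$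 and, for $r\ge-1$, $$G_{j,q,r}=\sum_{l=j}^{\left[\frac{j+q-1}{2}\right]}(-1)^l\binom{q-l-1}{l-j}x_{l,r+1}+\sum_{l=j}^{\left[\frac{j+q}{2}\right]}(-1)^l\binom{q-l}{l-j}x_{l,r+1}-(-1)^qx_{q,r+1}.$$ Finally, for $n\geq 5$ let $$\Psi=\sum_{s=0}^{n-5}\ \sum_{j=2}^{\left[\frac{n-1}{2}\right]}x_{j,s}\Psi_{j,s}.$$ **Theorem.** (1) Let $n=2k+1\ge 9$. Then $\Psi$ satisfies the deformation equation on $\mathfrak m_0(n)$ if and only if $F_{j,q,r}=0$ for all $2\le j<q$ and $r\ge0$ with $9\le j+2q+1+r\le n$. (2) Let $n=2k\ge 10$ and $x\in\{0,1\}$. Then $x\Psi_{k,-1}+\Psi$ satisfies the deformation equation on $\mathfrak m_0(2k)$ if and only if all of the following hold: - $F_{j,q,r}=0$ for all $2\le j<q$, $r\ge 0$ with $9\le j+2q+1+r<2k$; - $\tilde F_{j,q,r}=F_{j,q,r}+(-1)^{k-j-q}\,x\,G_{j,q,r}=0$ for all $2\le j<q$, $r\ge0$ with $j+2q+1+r=2k$;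 - $\tilde F_{j,q,-1}=x\,G_{j,q,-1}=0$ for all $2\le j<q$ with $j+2q=2k$. (The case $x=0$ concerns deformations of $\mathfrak m_0(2k)$; the case $x=1$ concerns deformations of $\mathfrak m_1(2k)$, whose bracket is that of $\mathfrak m_0(2k)$ plus $\Psi_{k,-1}$.) -/

import Mathlib

open Finset LieModule.Cohomology

namespace Filiform

noncomputable section

/-! ### The Lie algebra `m_0(n)` -/

/-- The underlying vector space of `m_0(n)`: coordinate vectors indexed by `1, …, n`. -/
def M0 (K : Type*) (n : ℕ) : Type _ := Set.Icc 1 n → K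

namespace M0

variable {K : Type*} [Field K] {n : ℕ}

instance instAddCommGroup : AddCommGroup (M0 K n) :=
  inferInstanceAs (AddCommGroup (Set.Icc 1 n → K))

instance instModule : Module K (M0 K n) :=
  inferInstanceAs (Module K (Set.Icc 1 n → K))

/-- The basis vector `e_i` for `1 ≤ i ≤ n`; by convention `e_i = 0` for all other `i`. -/
def e (i : ℕ) : M0 K n := fun p => if (p : ℕ) = i then 1 else 0

/-- The dual basis form `e^i` for `1 ≤ i ≤ n`; by convention `e^i = 0` for all other `i`. -/
def coord (i : ℕ) : M0 K n →ₗ[K] K where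
  toFun x := if h : i ∈ Set.Icc 1 n then x ⟨i, h⟩ else 0
  map_add' x y := by
    split_ifs
    · rfl
    · exact (add_zero 0).symm
  map_smul' t x := by
    split_ifs
    · rfl
    · exact (mul_zero t).symm

theorem coord_e (i j : ℕ) :
    coord i (e j : M0 K n) = if i = j ∧ 1 ≤ i ∧ i ≤ n then 1 else 0 := by
  change (if _h : i ∈ Set.Icc 1 n then (if i = j then (1 : K) else 0) else 0) = _
  simp only [Set.mem_Icc]
  split_ifs <;> first | rfl | (exfalso; tauto)

/-- The linear map `e_i ↦ e_{i+1}` for `2 ≤ i ≤ n - 1`, sending `e_1` and `e_n` to `0`. -/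
def shift : M0 K n →ₗ[K] M0 K n :=
  ∑ i ∈ Icc 2 (n - 1), (coord i).smulRight (e (i + 1))

theorem coord_one_shift (x : M0 K n) : coord 1 (shift x) = 0 := by
  rw [shift, LinearMap.sum_apply, map_sum]
  refine Finset.sum_eq_zero fun i hi => ?_
  have h2 : 2 ≤ i := (Finset.mem_Icc.1 hi).1
  rw [LinearMap.smulRight_apply, map_smul, coord_e, if_neg (by omega), smul_zero]

/-- The bracket of `m_0(n)`: the bilinear skew-symmetric map whose only nonzero values on pairs of
basis vectors are `[e_1, e_i] = e_{i+1} = -[e_i, e_1]`, `2 ≤ i ≤ n - 1` (see `lie_e_e`). -/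
instance instBracket : Bracket (M0 K n) (M0 K n) where
  bracket x y := coord 1 x • shift y - coord 1 y • shift x

theorem lie_def (x y : M0 K n) : ⁅x, y⁆ = coord 1 x • shift y - coord 1 y • shift x := rfl

theorem coord_one_lie (x y : M0 K n) : coord 1 ⁅x, y⁆ = 0 := by
  simp [lie_def, coord_one_shift]

instance instLieRing : LieRing (M0 K n) where
  add_lie x y z := by simp only [lie_def, map_add]; module
  lie_add x y z := by simp only [lie_def, map_add]; module
  lie_self x := by simp [lie_def]
  leibniz_lie x y z := by
    rw [lie_def x ⁅y, z⁆, lie_def ⁅x, y⁆ z, lie_def y ⁅x, z⁆]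
    simp only [coord_one_lie]
    simp only [lie_def, map_sub, map_smul]
    module

instance instLieAlgebra : LieAlgebra K (M0 K n) where
  lie_smul t x y := by
    simp only [lie_def, map_smul, smul_eq_mul]
    module

theorem shift_e (i : ℕ) :
    shift (e i : M0 K n) = if 2 ≤ i ∧ i + 1 ≤ n then e (i + 1) else 0 := by
  rw [shift, LinearMap.sum_apply]
  simp only [LinearMap.smulRight_apply, coord_e]
  split_ifs with h
  · rw [Finset.sum_eq_single i]
    · rw [if_pos (by omega), one_smul]
    · intro b _ hb
      rw [if_neg (by tauto), zero_smul]
    · intro hi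
      exact absurd (Finset.mem_Icc.2 ⟨h.1, by omega⟩) hi
  · refine Finset.sum_eq_zero fun b hb => ?_
    have hb' := Finset.mem_Icc.1 hb
    rw [if_neg (by omega), zero_smul]

/-- The structure relations of `m_0(n)` for `1 ≤ i < j`. -/
theorem lie_e_e (i j : ℕ) (hi : 1 ≤ i) (hij : i < j) :
    ⁅(e i : M0 K n), (e j : M0 K n)⁆ = if i = 1 ∧ j < n then e (j + 1) else 0 := by
  rw [lie_def, coord_e, coord_e, shift_e, shift_e]
  rw [if_neg (show ¬ (1 = j ∧ 1 ≤ 1 ∧ 1 ≤ n) by omega), zero_smul, sub_zero]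
  by_cases h : i = 1 ∧ j < n
  · rw [if_pos h, if_pos (by omega), if_pos (by omega), one_smul]
  · rw [if_neg h]
    by_cases h1 : i = 1
    · rw [if_neg (show ¬ (2 ≤ j ∧ j + 1 ≤ n) by omega), smul_zero]
    · rw [if_neg (show ¬ (1 = i ∧ 1 ≤ 1 ∧ 1 ≤ n) by omega), zero_smul]

end M0

/-! ### The deformation equation -/

section Deformation

variable {K : Type*} [Field K] {L : Type*} [LieRing L] [LieAlgebra K L]

/-- The Nijenhuis–Richardson bracket `[Ψ, Ψ̃]` of two 2-cochains with adjoint coefficients. -/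
def nrBracket (Ψ Φ : twoCochain K L L) (x y z : L) : L :=
  Ψ (Φ x y) z + Ψ (Φ y z) x + Ψ (Φ z x) y + Φ (Ψ x y) z + Φ (Ψ y z) x + Φ (Ψ z x) y

/-- The deformation equation `dΨ + ½ [Ψ, Ψ] = 0`. The sign of the differential is the one for which
this equation is the Jacobi identity of `[·,·] + Ψ` (see `deformationEquation_iff_jacobi`), namely
`dΨ(x,y,z) = Ψ([x,y],z) + [Ψ(x,y),z] + (cyclic permutations)`; it is opposite to Mathlib's `d₂₃`. -/
def DeformationEquation (Ψ : twoCochain K L L) : Prop :=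
  ∀ x y z : L, -(d₂₃ K L L Ψ x y z) + (2⁻¹ : K) • nrBracket Ψ Ψ x y z = 0

/-- The deformed bracket `[·,·]' = [·,·] + Ψ`. -/
def deformedBracket (Ψ : twoCochain K L L) (x y : L) : L := ⁅x, y⁆ + Ψ x y

theorem deformationEquation_iff_jacobi (h2 : (2 : K) ≠ 0) (Ψ : twoCochain K L L) :
    DeformationEquation Ψ ↔ ∀ x y z : L,
      deformedBracket Ψ (deformedBracket Ψ x y) z + deformedBracket Ψ (deformedBracket Ψ y z) x +
        deformedBracket Ψ (deformedBracket Ψ z x) y = 0 := by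
  refine forall_congr' fun x => forall_congr' fun y => forall_congr' fun z => ?_
  have half : (2⁻¹ : K) • nrBracket Ψ Ψ x y z =
      Ψ (Ψ x y) z + Ψ (Ψ y z) x + Ψ (Ψ z x) y := by
    have h : nrBracket Ψ Ψ x y z = (2 : K) • (Ψ (Ψ x y) z + Ψ (Ψ y z) x + Ψ (Ψ z x) y) := by
      rw [nrBracket]; module
    rw [h, smul_smul, inv_mul_cancel₀ h2, one_smul]
  have jac : ⁅⁅x, y⁆, z⁆ + ⁅⁅y, z⁆, x⁆ + ⁅⁅z, x⁆, y⁆ = 0 := by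
    have := lie_jacobi x y z
    rw [← lie_skew x ⁅y, z⁆, ← lie_skew y ⁅z, x⁆, ← lie_skew z ⁅x, y⁆] at this
    rw [← neg_eq_zero, ← this]
    abel
  rw [half, d₂₃_apply]
  simp only [deformedBracket, map_add, LinearMap.add_apply, add_lie]
  have e1 : ⁅x, Ψ y z⁆ = -⁅Ψ y z, x⁆ := (lie_skew _ _).symm
  have e2 : ⁅y, Ψ x z⁆ = ⁅Ψ z x, y⁆ := by
    rw [← twoCochain_skew Ψ z x, lie_neg, lie_skew]
  have e3 : ⁅z, Ψ x y⁆ = -⁅Ψ x y, z⁆ := (lie_skew _ _).symm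
  have e4 : Ψ ⁅x, z⁆ y = -Ψ ⁅z, x⁆ y := by
    rw [← lie_skew x z, map_neg, LinearMap.neg_apply]
  rw [e1, e2, e3, e4]
  constructor
  · intro h
    rw [← add_zero (0 : L)]
    nth_rewrite 1 [← h]
    rw [← jac]
    abel
  · intro h
    rw [← sub_zero (0 : L)]
    nth_rewrite 1 [← h]
    rw [← jac]
    abel

end Deformation

/-! ### The cocycles -/

section Cocycles

variable (K : Type*) [Field K] (n : ℕ)

open M0

/-- The 2-cochain `e_p ⊗ e^a ∧ e^b` of `m_0(n)` with adjoint coefficients. -/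
def monomial (p a b : ℕ) : twoCochain K (M0 K n) (M0 K n) where
  val := LinearMap.mk₂ K
    (fun x y => (coord a x * coord b y - coord b x * coord a y) • (e p : M0 K n))
    (fun x x' y => by simp only [map_add]; module)
    (fun t x y => by simp only [map_smul, smul_eq_mul]; module)
    (fun x y y' => by simp only [map_add]; module)
    (fun t x y => by simp only [map_smul, smul_eq_mul]; module)
  property := fun x => by simp [mul_comm]

/-- The cocycle `Ψ_{j,s}` of `m_0(n)`, given by its values
`Ψ_{j,s}(e_a, e_b) = (-1)^(j-a) * C(b-j-1, j-a) e_{a+b+s}` for `2 ≤ a ≤ j < b ≤ n`,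
`a + b ≥ 2j + 1`, and zero on the other pairs `a < b`. (As `e_i = 0` for `i > n`, it vanishes when
`2j + 1 + s > n`.) -/
def cocycle (j s : ℕ) : twoCochain K (M0 K n) (M0 K n) :=
  ∑ a ∈ Icc 2 j, ∑ b ∈ Icc (j + 1) n with 2 * j + 1 ≤ a + b,
    ((-1 : K) ^ (j - a) * ((b - j - 1).choose (j - a) : K)) • monomial K n (a + b + s) a b

/-- The cocycle `Ψ_{k,-1} = e_{2k} ⊗ ω(e^k ∧ e^{k+1})` of `m_0(2k)`, where
`ω(e^k ∧ e^{k+1}) = ∑_{l=0}^{k-2} (-1)^l e^{k-l} ∧ e^{k+1+l}`. -/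
def cocycleNegOne (k : ℕ) : twoCochain K (M0 K (2 * k)) (M0 K (2 * k)) :=
  ∑ l ∈ range (k - 1), (-1 : K) ^ l • monomial K (2 * k) (2 * k) (k - l) (k + 1 + l)

variable {K}

/-- The linear combination `∑_{s=0}^{n-5} ∑_{j=2}^{[(n-1)/2]} x_{j,s} Ψ_{j,s}` (for `n ≥ 5`). -/
def combination (x : ℕ → ℕ → K) : twoCochain K (M0 K n) (M0 K n) :=
  ∑ s ∈ range (n - 4), ∑ j ∈ Icc 2 ((n - 1) / 2), x j s • cocycle K n j s

theorem sum_cochain_apply {ι : Type*} (S : Finset ι)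
    (f : ι → twoCochain K (M0 K n) (M0 K n)) (u v : M0 K n) :
    (∑ i ∈ S, f i) u v = ∑ i ∈ S, f i u v := by
  classical
  induction S using Finset.induction_on with
  | empty => simp only [Finset.sum_empty]; rfl
  | insert a S ha ih => rw [Finset.sum_insert ha, Finset.sum_insert ha, add_apply_apply, ih]

theorem monomial_e_e (p a b i j : ℕ) (hij : i < j) (hab : a < b) (ha : 1 ≤ a) (hb : b ≤ n) :
    monomial K n p a b (e i) (e j) = if a = i ∧ b = j then (e p : M0 K n) else 0 := by
  change (coord a (e i : M0 K n) * coord b (e j : M0 K n) -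
    coord b (e i : M0 K n) * coord a (e j : M0 K n)) • (e p : M0 K n) = _
  simp only [coord_e]
  by_cases h : a = i ∧ b = j
  · rw [if_pos (by omega), if_pos (by omega), if_neg (by omega), if_pos h]
    simp
  · rw [if_neg h]
    by_cases h1 : a = i
    · rw [if_neg (show ¬ (b = j ∧ 1 ≤ b ∧ b ≤ n) by omega),
        if_neg (show ¬ (b = i ∧ 1 ≤ b ∧ b ≤ n) by omega)]
      simp
    · rw [if_neg (show ¬ (a = i ∧ 1 ≤ a ∧ a ≤ n) by omega)]
      by_cases h3 : b = i
      · rw [if_neg (show ¬ (a = j ∧ 1 ≤ a ∧ a ≤ n) by omega)]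
        simp
      · rw [if_neg (show ¬ (b = i ∧ 1 ≤ b ∧ b ≤ n) by omega)]
        simp

/-- The table of values of `Ψ_{j,s}`. -/
theorem cocycle_e_e (j s a b : ℕ) (hab : a < b) (hb : b ≤ n) :
    cocycle K n j s (e a) (e b) =
      if 2 ≤ a ∧ a ≤ j ∧ j < b ∧ 2 * j + 1 ≤ a + b then
        ((-1 : K) ^ (j - a) * ((b - j - 1).choose (j - a) : K)) • (e (a + b + s) : M0 K n)
      else 0 := by
  have key : ∀ a' ∈ Icc 2 j, ∀ b' ∈ Finset.filter (fun b' => 2 * j + 1 ≤ a' + b') (Icc (j + 1) n),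
      (((-1 : K) ^ (j - a') * ((b' - j - 1).choose (j - a') : K)) •
        monomial K n (a' + b' + s) a' b') (e a) (e b) =
      if a' = a ∧ b' = b then
        ((-1 : K) ^ (j - a) * ((b - j - 1).choose (j - a) : K)) • (e (a + b + s) : M0 K n)
      else 0 := by
    intro a' ha' b' hb'
    have h1 := Finset.mem_Icc.1 ha'
    have h2 := Finset.mem_Icc.1 (Finset.mem_filter.1 hb').1
    rw [smul_apply_apply, monomial_e_e n _ _ _ _ _ hab (by omega) (by omega) h2.2]
    split_ifs with h
    · rw [h.1, h.2]
    · rw [smul_zero]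
  rw [cocycle, sum_cochain_apply]
  simp only [sum_cochain_apply]
  rw [Finset.sum_congr rfl fun a' ha' => Finset.sum_congr rfl fun b' hb' => key a' ha' b' hb']
  split_ifs with h
  · rw [Finset.sum_eq_single a, Finset.sum_eq_single b]
    · simp
    · intro b' _ hne
      rw [if_neg (by tauto)]
    · intro hn
      exact absurd (Finset.mem_filter.2 ⟨Finset.mem_Icc.2 (by omega), by omega⟩) hn
    · intro a' _ hne
      exact Finset.sum_eq_zero fun b' _ => if_neg (by tauto)
    · intro hn
      exact absurd (Finset.mem_Icc.2 (by omega)) hn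
  · refine Finset.sum_eq_zero fun a' ha' => Finset.sum_eq_zero fun b' hb' => if_neg ?_
    have h1 := Finset.mem_Icc.1 ha'
    have h2 := Finset.mem_Icc.1 (Finset.mem_filter.1 hb').1
    have h3 := (Finset.mem_filter.1 hb').2
    omega

/-- The table of values of `Ψ_{k,-1}`. -/
theorem cocycleNegOne_e_e (k a b : ℕ) (ha : 1 ≤ a) (hab : a < b) (hb : b ≤ 2 * k) :
    cocycleNegOne K k (e a) (e b) =
      if 2 ≤ a ∧ a + b = 2 * k + 1 then (-1 : K) ^ (k - a) • (e (2 * k) : M0 K (2 * k)) else 0 := by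
  have key : ∀ l ∈ range (k - 1),
      ((-1 : K) ^ l • monomial K (2 * k) (2 * k) (k - l) (k + 1 + l)) (e a) (e b) =
      if k - l = a ∧ k + 1 + l = b then (-1 : K) ^ l • (e (2 * k) : M0 K (2 * k)) else 0 := by
    intro l hl
    have h1 := Finset.mem_range.1 hl
    rw [smul_apply_apply, monomial_e_e _ _ _ _ _ _ hab (by omega) (by omega) (by omega)]
    split_ifs with h
    · rfl
    · rw [smul_zero]
  rw [cocycleNegOne, sum_cochain_apply, Finset.sum_congr rfl key]
  split_ifs with h
  · rw [Finset.sum_eq_single (k - a)]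
    · rw [if_pos (by omega)]
    · intro l hl hne
      have h1 := Finset.mem_range.1 hl
      rw [if_neg (by omega)]
    · intro hn
      exact absurd (Finset.mem_range.2 (by omega)) hn
  · refine Finset.sum_eq_zero fun l hl => if_neg ?_
    have h1 := Finset.mem_range.1 hl
    omega

/-- The deformed bracket `[·,·] + Ψ_{k,-1}` on `m_0(2k)` satisfies the relations of `m_1(2k)`:
`[e_1, e_i] = e_{i+1}` for `2 ≤ i ≤ 2k - 1`, `[e_j, e_{2k+1-j}] = (-1)^(j+k) e_{2k}` for
`2 ≤ j ≤ k`, the other brackets of basis vectors `e_i, e_j`, `i < j`, being zero. -/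
theorem deformedBracket_cocycleNegOne (k i j : ℕ) (hi : 1 ≤ i) (hij : i < j) (hj : j ≤ 2 * k) :
    deformedBracket (cocycleNegOne K k) (e i) (e j) =
      if i = 1 ∧ j < 2 * k then e (j + 1)
      else if 2 ≤ i ∧ i + j = 2 * k + 1 then (-1 : K) ^ (i + k) • (e (2 * k) : M0 K (2 * k))
      else 0 := by
  rw [deformedBracket, lie_e_e i j hi hij, cocycleNegOne_e_e k i j hi hij hj]
  by_cases h : i = 1 ∧ j < 2 * k
  · rw [if_pos h, if_pos h, if_neg (by omega), add_zero]
  · rw [if_neg h, if_neg h, zero_add]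
    by_cases h' : 2 ≤ i ∧ i + j = 2 * k + 1
    · rw [if_pos h', if_pos h', show i + k = (k - i) + 2 * i by omega, pow_add, pow_mul]
      simp
    · rw [if_neg h', if_neg h']

end Cocycles

/-! ### The polynomials -/

section Polynomials

variable {K : Type*} [Field K]

/-- The value of the quadratic polynomial `F_{j,q,r}` (`2 ≤ j < q`, `r ≥ 0`) at `x = (x_{j,s})`. In
all the binomial coefficients and exponents the subtractions are of a smaller number from a larger
one. -/
def F (x : ℕ → ℕ → K) (j q r : ℕ) : K :=
  (∑ t ∈ Icc 0 r, ∑ l ∈ Icc j ((j + q - 1) / 2), ∑ m ∈ Icc (q + 1) (q + (j + t) / 2),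
    (-1 : K) ^ ((l - j) + (m - q)) * ((q - l - 1).choose (l - j) : K) *
      ((j + q + t - m - 1).choose (m - q - 1) : K) * x l t * x m (r - t)) +
  (∑ t ∈ Icc 0 r, ∑ l ∈ Icc j ((j + q) / 2), ∑ m ∈ Icc q (q + (j + t) / 2),
    (-1 : K) ^ ((l - j) + (m - q)) * ((q - l).choose (l - j) : K) *
      ((j + q + t - m).choose (m - q) : K) * x l t * x m (r - t)) +
  (∑ t ∈ Icc 0 r, ∑ m ∈ Icc j (q + (j + t) / 2),
    (-1 : K) ^ ((m - j) + 1) * ((2 * q + t - m).choose (m - j) : K) * x q t * x m (r - t))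

/-- The value of the linear polynomial `G_{j,q,r}` (`2 ≤ j < q`, `r ≥ -1`) at `x = (x_{j,s})`. -/
def G (x : ℕ → ℕ → K) (j q : ℕ) (r : ℤ) : K :=
  (∑ l ∈ Icc j ((j + q - 1) / 2),
    (-1 : K) ^ l * ((q - l - 1).choose (l - j) : K) * x l (r + 1).toNat) +
  (∑ l ∈ Icc j ((j + q) / 2),
    (-1 : K) ^ l * ((q - l).choose (l - j) : K) * x l (r + 1).toNat) -
  (-1 : K) ^ q * x q (r + 1).toNat

end Polynomials

end

end Filiform

namespace Filiform

/-! ### Coordinates and the action of `shift` on basis vectors. -/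

namespace M0

variable {K : Type*} [Field K] {n : ℕ}

/-! Every cochain Ψ considered here kills e_1, takes values with no e_1-component, and has `shift`
(bracketing with e_1) as a derivation. These facts make the linear part dΨ vanish, so the
deformation equation becomes S = 0, where S = `cyclicSquare` Ψ is half the Nijenhuis–Richardson
square (`deformationEquation_iff_cyclicSquare`).

S is trilinear and alternating, and `shift` acts on it by the Leibniz rule. Applying `shift` to a
vanishing S(e_a, e_b, e_c) expresses S(e_a, e_b, e_{c+1}) through triples whose last two indices are
closer together. Hence S is determined by the triples (e_j, e_q, e_{q+1}), and those with j = 1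
vanish trivially (`IsShiftDerivation.cyclicSquare_eq_zero_iff`).

What remains is to read coordinates. Write Ψ(e_a, e_b) as the sum over s of c(a,b,s) e_{a+b+s}, with
c = `pairCoeff`. Then the coefficient of e_{j+2q+1+r} in S(e_j, e_q, e_{q+1}) is a convolution of
products of c's, and this is F_{j,q,r} (`coord_cyclicSquare_combination`).

In the even case Ψ_{k,-1} has values in the line of e_{2k}, which is annihilated by a further
product with any e_c, c ≥ 2. Only the cross terms Ψ_{k,-1}(e_c, Ψ(e_a, e_b)) survive. They are
linear in x and touch only the e_{2k}-coordinate, where they give G with index r = 2k - (j+2q+1),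
possibly -1 (`coord_cyclicSquare_add`). -/

theorem ext_coord {x y : M0 K n} (h : ∀ p ∈ Set.Icc 1 n, coord p x = coord p y) : x = y := by
  refine funext fun p => ?_
  have := h p p.2
  change (if h : (p : ℕ) ∈ Set.Icc 1 n then x ⟨p, h⟩ else 0) =
    (if h : (p : ℕ) ∈ Set.Icc 1 n then y ⟨p, h⟩ else 0) at this
  rwa [dif_pos p.2, dif_pos p.2] at this

theorem e_eq_zero {i : ℕ} (h : n < i) : (e i : M0 K n) = 0 :=
  ext_coord fun p hp => by
    rw [coord_e, if_neg (by have := hp.2; omega), map_zero]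

theorem eq_sum_coord (x : M0 K n) : x = ∑ i ∈ Icc 1 n, coord i x • e i := by
  refine ext_coord fun p hp => ?_
  rw [map_sum, Finset.sum_eq_single p]
  · rw [map_smul, coord_e, if_pos ⟨rfl, hp.1, hp.2⟩, smul_eq_mul, mul_one]
  · intro i _ hi
    rw [map_smul, coord_e, if_neg (by omega), smul_zero]
  · intro h
    exact absurd (Finset.mem_Icc.2 hp) h

/-- A property closed under linear combinations holds everywhere if it holds on the basis. -/
theorem induction_e {p : M0 K n → Prop} (zero : p 0) (add : ∀ x y, p x → p y → p (x + y))
    (smul : ∀ (t : K) x, p x → p (t • x)) (basis : ∀ i, 1 ≤ i → i ≤ n → p (e i)) (x : M0 K n) :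
    p x := by
  rw [eq_sum_coord x]
  exact Finset.sum_induction _ p add zero fun i hi =>
    smul _ _ (basis i (Finset.mem_Icc.1 hi).1 (Finset.mem_Icc.1 hi).2)

theorem shift_e_one : shift (e 1 : M0 K n) = 0 := by
  rw [shift_e, if_neg (by omega)]

theorem shift_e_of_two_le {i : ℕ} (h : 2 ≤ i) : shift (e i : M0 K n) = e (i + 1) := by
  rw [shift_e]
  split_ifs with h'
  · rfl
  · rw [e_eq_zero (by omega)]

end M0

open M0

/-! ### Reduction of the deformation equation to the triples (e_j, e_q, e_{q+1}). -/

section Derivation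

variable {K : Type*} [Field K] {n : ℕ}

/-- The cyclic sum `∑ Ψ(Ψ(x, y), z)`, that is `½ [Ψ, Ψ](x, y, z)`. -/
def cyclicSquare (Ψ : twoCochain K (M0 K n) (M0 K n)) (x y z : M0 K n) : M0 K n :=
  Ψ (Ψ x y) z + Ψ (Ψ y z) x + Ψ (Ψ z x) y

/-- `shift` is a derivation of the product `Ψ`. -/
def IsShiftDerivation (Ψ : twoCochain K (M0 K n) (M0 K n)) : Prop :=
  ∀ x y, Ψ (shift x) y + Ψ x (shift y) = shift (Ψ x y)

theorem IsShiftDerivation.add {Ψ Φ : twoCochain K (M0 K n) (M0 K n)}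
    (hΨ : IsShiftDerivation Ψ) (hΦ : IsShiftDerivation Φ) : IsShiftDerivation (Ψ + Φ) := by
  intro x y
  simp only [add_apply_apply, map_add, ← hΨ x y, ← hΦ x y]
  abel

theorem IsShiftDerivation.smul {Ψ : twoCochain K (M0 K n) (M0 K n)}
    (hΨ : IsShiftDerivation Ψ) (t : K) : IsShiftDerivation (t • Ψ) := by
  intro x y
  simp only [smul_apply_apply, map_smul, ← hΨ x y, smul_add]

theorem isShiftDerivation_zero : IsShiftDerivation (0 : twoCochain K (M0 K n) (M0 K n)) := by
  intro x y
  have h : ∀ u v : M0 K n, (0 : twoCochain K (M0 K n) (M0 K n)) u v = 0 := fun _ _ => rfl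
  rw [h, h, h, map_zero, add_zero]

theorem isShiftDerivation_sum {ι : Type*} (S : Finset ι)
    (f : ι → twoCochain K (M0 K n) (M0 K n)) (h : ∀ i ∈ S, IsShiftDerivation (f i)) :
    IsShiftDerivation (∑ i ∈ S, f i) :=
  Finset.sum_induction f IsShiftDerivation (fun _ _ => IsShiftDerivation.add)
    isShiftDerivation_zero h

/-- By skew-symmetry the Leibniz identity is automatic on the diagonal and only changes sign when
the arguments are exchanged, so ordered pairs suffice. Pairs with e_1 are trivial because `shift`
and Ψ both kill it. -/
theorem isShiftDerivation_of_basis {Ψ : twoCochain K (M0 K n) (M0 K n)}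
    (h1 : ∀ b, 1 < b → Ψ (e 1) (e b) = 0)
    (h : ∀ a b, 2 ≤ a → a < b →
      Ψ (e (a + 1)) (e b) + Ψ (e a) (e (b + 1)) = shift (Ψ (e a) (e b))) :
    IsShiftDerivation Ψ := by
  have key : ∀ a b, 1 ≤ a → a < b →
      Ψ (shift (e a)) (e b) + Ψ (e a) (shift (e b)) = shift (Ψ (e a) (e b)) := by
    intro a b ha hab
    rw [shift_e_of_two_le (show 2 ≤ b by omega)]
    rcases eq_or_lt_of_le ha with rfl | ha
    · rw [shift_e_one, h1 _ hab, h1 _ (by omega), map_zero, map_zero, LinearMap.zero_apply,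
        add_zero]
    · rw [shift_e_of_two_le ha, h a b ha hab]
  refine fun x => induction_e ?_ ?_ ?_ (fun b hb _ => ?_)
  · simp
  · intro y z hy hz
    simp only [map_add, ← hy, ← hz]
    abel
  · intro t y hy
    simp only [map_smul, ← hy, smul_add]
  revert x
  refine induction_e ?_ ?_ ?_ (fun a ha _ => ?_)
  · simp
  · intro y z hy hz
    simp only [map_add, LinearMap.add_apply, ← hy, ← hz]
    abel
  · intro t y hy
    simp only [map_smul, LinearMap.smul_apply, ← hy, smul_add]
  rcases lt_trichotomy a b with hab | rfl | hab
  · exact key a b ha hab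
  · rw [← twoCochain_skew Ψ (e a) (shift (e a)), twoCochain_alt, map_zero]
    exact neg_add_cancel _
  · rw [← twoCochain_skew Ψ (e b) (shift (e a)), ← twoCochain_skew Ψ (shift (e b)) (e a),
      ← twoCochain_skew Ψ (e b) (e a), map_neg, ← key b a hb hab]
    abel

/-- In the Jacobi sum the terms linear in Ψ carry a factor `coord 1` of one argument. The factor of
z multiplies Ψ(shift x, y) + Ψ(x, shift y) - shift Ψ(x, y), which is zero, and likewise cyclically.
The doubled Lie brackets cancel on their own. -/
theorem deformationEquation_iff_cyclicSquare (h2 : (2 : K) ≠ 0)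
    {Ψ : twoCochain K (M0 K n) (M0 K n)} (hD : IsShiftDerivation Ψ)
    (hΨ : ∀ x y, coord 1 (Ψ x y) = 0) :
    DeformationEquation Ψ ↔ ∀ x y z, cyclicSquare Ψ x y z = 0 := by
  rw [deformationEquation_iff_jacobi h2]
  refine forall_congr' fun x => forall_congr' fun y => forall_congr' fun z => ?_
  have key : deformedBracket Ψ (deformedBracket Ψ x y) z +
      deformedBracket Ψ (deformedBracket Ψ y z) x +
        deformedBracket Ψ (deformedBracket Ψ z x) y = cyclicSquare Ψ x y z := by
    simp only [deformedBracket, lie_def, map_add, map_sub, map_smul, coord_one_shift, hΨ,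
      LinearMap.add_apply, LinearMap.sub_apply, LinearMap.smul_apply, cyclicSquare, ← hD x y,
      ← hD y z, ← hD z x]
    rw [← twoCochain_skew Ψ x (shift y), ← twoCochain_skew Ψ y (shift z),
      ← twoCochain_skew Ψ z (shift x)]
    simp only [sub_zero, smul_eq_mul, mul_zero, add_zero]
    module
  rw [key]

/-- A derivation of a product is a derivation of every iterated product; this drives the induction
on index gaps. -/
theorem IsShiftDerivation.shift_cyclicSquare {Ψ : twoCochain K (M0 K n) (M0 K n)}
    (hD : IsShiftDerivation Ψ) (x y z : M0 K n) :
    shift (cyclicSquare Ψ x y z) = cyclicSquare Ψ (shift x) y z + cyclicSquare Ψ x (shift y) z +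
      cyclicSquare Ψ x y (shift z) := by
  simp only [cyclicSquare, map_add, ← hD _ _, LinearMap.add_apply]
  abel

theorem cyclicSquare_rotate (Ψ : twoCochain K (M0 K n) (M0 K n)) (x y z : M0 K n) :
    cyclicSquare Ψ y z x = cyclicSquare Ψ x y z := by
  simp only [cyclicSquare]
  abel

theorem cyclicSquare_swap (Ψ : twoCochain K (M0 K n) (M0 K n)) (x y z : M0 K n) :
    cyclicSquare Ψ y x z = -cyclicSquare Ψ x y z := by
  simp only [cyclicSquare]
  rw [← twoCochain_skew Ψ x y, ← twoCochain_skew Ψ z x, ← twoCochain_skew Ψ y z]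
  simp only [map_neg, LinearMap.neg_apply]
  abel

theorem cyclicSquare_self (Ψ : twoCochain K (M0 K n) (M0 K n)) (x z : M0 K n) :
    cyclicSquare Ψ x x z = 0 := by
  simp only [cyclicSquare, twoCochain_alt]
  rw [← twoCochain_skew Ψ x z]
  simp

theorem cyclicSquare_eq_zero_of_basis {Ψ : twoCochain K (M0 K n) (M0 K n)}
    (h : ∀ a b c, 1 ≤ a → a < b → b < c → cyclicSquare Ψ (e a) (e b) (e c) = 0)
    (x y z : M0 K n) : cyclicSquare Ψ x y z = 0 := by
  have hle : ∀ a b c, 1 ≤ a → a ≤ b → b ≤ c → cyclicSquare Ψ (e a) (e b) (e c) = 0 := by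
    intro a b c ha hab hbc
    rcases eq_or_lt_of_le hab with rfl | hab
    · exact cyclicSquare_self Ψ _ _
    rcases eq_or_lt_of_le hbc with rfl | hbc
    · rw [← cyclicSquare_rotate]
      exact cyclicSquare_self Ψ _ _
    exact h a b c ha hab hbc
  have hmin : ∀ a b c, 1 ≤ a → a ≤ b → a ≤ c → cyclicSquare Ψ (e a) (e b) (e c) = 0 := by
    intro a b c ha hab hac
    rcases le_total b c with hbc | hbc
    · exact hle a b c ha hab hbc
    · rw [← cyclicSquare_rotate, ← cyclicSquare_rotate, cyclicSquare_swap, hle a c b ha hac hbc,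
        neg_zero]
  have hall : ∀ a b c, 1 ≤ a → 1 ≤ b → 1 ≤ c → cyclicSquare Ψ (e a) (e b) (e c) = 0 := by
    intro a b c ha hb hc
    by_cases h1 : a ≤ b ∧ a ≤ c
    · exact hmin a b c ha h1.1 h1.2
    by_cases h2 : b ≤ a ∧ b ≤ c
    · rw [← cyclicSquare_rotate]
      exact hmin b c a hb h2.2 h2.1
    · rw [← cyclicSquare_rotate, ← cyclicSquare_rotate]
      exact hmin c a b hc (by omega) (by omega)
  have hlin : ∀ u v : M0 K n, (∀ i, 1 ≤ i → i ≤ n → cyclicSquare Ψ u v (e i) = 0) →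
      ∀ w, cyclicSquare Ψ u v w = 0 := by
    intro u v huv
    refine induction_e ?_ ?_ ?_ huv
    · simp [cyclicSquare]
    · intro w w' hw hw'
      rw [← add_zero (0 : M0 K n)]
      nth_rewrite 1 [← hw]
      rw [← hw']
      simp only [cyclicSquare, map_add, LinearMap.add_apply]
      abel
    · intro t w hw
      rw [← smul_zero t, ← hw]
      simp only [cyclicSquare, map_smul, LinearMap.smul_apply, smul_add]
  refine hlin x y (fun c hc _ => ?_) z
  rw [← cyclicSquare_rotate, ← cyclicSquare_rotate]
  refine hlin _ x (fun b hb _ => ?_) y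
  rw [← cyclicSquare_rotate, ← cyclicSquare_rotate]
  exact hlin _ _ (fun a ha _ => hall b c a hb hc ha) x

/-- The cyclic square vanishes as soon as it vanishes on the triples `(e_j, e_q, e_{q+1})`. -/
theorem IsShiftDerivation.cyclicSquare_eq_zero_iff {Ψ : twoCochain K (M0 K n) (M0 K n)}
    (hD : IsShiftDerivation Ψ) (h1 : ∀ y, Ψ (e 1) y = 0) :
    (∀ x y z, cyclicSquare Ψ x y z = 0) ↔
      ∀ j q, 2 ≤ j → j < q → cyclicSquare Ψ (e j) (e q) (e (q + 1)) = 0 := by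
  refine ⟨fun h j q _ _ => h _ _ _, fun h => ?_⟩
  -- Strong induction on the gap d between the last two indices, for all a < b at once. In the
  -- Leibniz expansion at gap d, raising the first index keeps the gap, raising the second lowers
  -- it, and raising the third gives the new triple of gap d + 1.
  have key : ∀ d a b, 2 ≤ a → a < b → cyclicSquare Ψ (e a) (e b) (e (b + 1 + d)) = 0 := by
    intro d
    induction d using Nat.strong_induction_on with
    | _ d ih =>
    rcases d with _ | d
    · exact h
    · intro a b ha hab
      have hs := hD.shift_cyclicSquare (e a) (e b) (e (b + 1 + d))
      rw [shift_e_of_two_le ha, shift_e_of_two_le (show 2 ≤ b by omega),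
        shift_e_of_two_le (show 2 ≤ b + 1 + d by omega), ih d (by omega) a b ha hab,
        map_zero] at hs
      -- Raising an index may make two arguments coincide (a + 1 = b here, d = 0 in `h4`);
      -- alternation covers these cases.
      have h3 : cyclicSquare Ψ (e (a + 1)) (e b) (e (b + 1 + d)) = 0 := by
        rcases eq_or_lt_of_le (show a + 1 ≤ b from hab) with rfl | hab'
        · exact cyclicSquare_self Ψ _ _
        · exact ih d (by omega) (a + 1) b (by omega) hab'
      have h4 : cyclicSquare Ψ (e a) (e (b + 1)) (e (b + 1 + d)) = 0 := by
        rcases d with _ | d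
        · rw [← cyclicSquare_rotate]
          exact cyclicSquare_self Ψ _ _
        · rw [show b + 1 + (d + 1) = b + 1 + 1 + d by omega]
          exact ih d (by omega) a (b + 1) ha (by omega)
      rw [h3, h4, zero_add, zero_add] at hs
      exact hs.symm
  refine cyclicSquare_eq_zero_of_basis fun a b c ha hab hbc => ?_
  rcases eq_or_lt_of_le ha with rfl | ha
  · have h1' : ∀ y, Ψ y (e 1) = 0 := fun y => by rw [← twoCochain_skew, h1, neg_zero]
    simp [cyclicSquare, h1, h1']
  · obtain ⟨d, rfl⟩ := Nat.exists_eq_add_of_le (show b + 1 ≤ c from hbc)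
    exact key d a b ha hab

end Derivation

end Filiform

namespace Filiform

open M0

/-! ### Structure constants of the combination and the polynomials F. -/

section Tables

variable {K : Type*} [Field K] {n : ℕ}

theorem coord_one_apply_eq_zero {Ψ : twoCochain K (M0 K n) (M0 K n)}
    (h : ∀ a b, 1 ≤ a → a < b → coord 1 (Ψ (e a) (e b)) = 0) (x y : M0 K n) :
    coord 1 (Ψ x y) = 0 := by
  revert y
  refine induction_e ?_ ?_ ?_ (fun b hb _ => ?_)
  · simp
  · intro y z hy hz
    rw [map_add, map_add, hy, hz, add_zero]
  · intro t y hy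
    rw [map_smul, map_smul, hy, smul_zero]
  revert x
  refine induction_e ?_ ?_ ?_ (fun a ha _ => ?_)
  · simp
  · intro y z hy hz
    rw [map_add, LinearMap.add_apply, map_add, hy, hz, add_zero]
  · intro t y hy
    rw [map_smul, LinearMap.smul_apply, map_smul, hy, smul_zero]
  rcases lt_trichotomy a b with hab | rfl | hab
  · exact h a b ha hab
  · rw [twoCochain_alt, map_zero]
  · rw [← twoCochain_skew, map_neg, h b a hb hab, neg_zero]

theorem apply_e_one_eq_zero {Ψ : twoCochain K (M0 K n) (M0 K n)}
    (h : ∀ b, 1 < b → Ψ (e 1) (e b) = 0) (y : M0 K n) : Ψ (e 1) y = 0 := by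
  revert y
  refine induction_e ?_ ?_ ?_ (fun b hb _ => ?_)
  · simp
  · intro y z hy hz
    rw [map_add, hy, hz, add_zero]
  · intro t y hy
    rw [map_smul, hy, smul_zero]
  rcases eq_or_lt_of_le hb with rfl | hb
  · exact twoCochain_alt _ _
  · exact h b hb

/-- The table of values of `Ψ_{j,s}`, with no upper bound on the indices. -/
theorem cocycle_e_e_of_lt (j s : ℕ) {a b : ℕ} (hab : a < b) :
    cocycle K n j s (e a) (e b) =
      if 2 ≤ a ∧ a ≤ j ∧ 2 * j + 1 ≤ a + b then
        ((-1 : K) ^ (j - a) * ((b - j - 1).choose (j - a) : K)) • (e (a + b + s) : M0 K n)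
      else 0 := by
  rcases le_or_gt b n with hb | hb
  · rw [cocycle_e_e n j s a b hab hb]
    exact if_congr (by omega) rfl rfl
  · rw [e_eq_zero hb, e_eq_zero (show n < a + b + s by omega), map_zero, smul_zero, ite_self]

/-- This is Pascal's rule with alternating signs. It degenerates at two edges: for a = j only one
left-hand term survives, with coefficient 1 on both sides, and for a + b = 2j the right side is zero
while the left coefficients are 1 and -1 up to sign. -/
theorem isShiftDerivation_cocycle (j s : ℕ) : IsShiftDerivation (cocycle K n j s) := by
  refine isShiftDerivation_of_basis (fun b hb => ?_) (fun a b ha hab => ?_)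
  · rw [cocycle_e_e_of_lt j s hb, if_neg (by omega)]
  have hr : shift (cocycle K n j s (e a) (e b)) =
      if a ≤ j ∧ 2 * j + 1 ≤ a + b then
        ((-1 : K) ^ (j - a) * ((b - j - 1).choose (j - a) : K)) • (e (a + b + s + 1) : M0 K n)
      else 0 := by
    rw [cocycle_e_e_of_lt j s hab]
    by_cases h : a ≤ j ∧ 2 * j + 1 ≤ a + b
    · rw [if_pos ⟨ha, h⟩, if_pos h, map_smul, shift_e_of_two_le (by omega)]
    · rw [if_neg (by tauto), if_neg h, map_zero]
  have hl : cocycle K n j s (e (a + 1)) (e b) =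
      if a + 1 ≤ j ∧ 2 * j ≤ a + b then
        ((-1 : K) ^ (j - (a + 1)) * ((b - j - 1).choose (j - (a + 1)) : K)) •
          (e (a + b + s + 1) : M0 K n)
      else 0 := by
    rcases eq_or_lt_of_le (show a + 1 ≤ b from hab) with rfl | hab'
    · rw [twoCochain_alt, if_neg (by omega)]
    · rw [cocycle_e_e_of_lt j s hab', show a + 1 + b + s = a + b + s + 1 by omega]
      exact if_congr (by omega) rfl rfl
  rw [hr, hl, cocycle_e_e_of_lt j s (show a < b + 1 by omega),
    show a + (b + 1) + s = a + b + s + 1 by omega]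
  by_cases h : a ≤ j ∧ 2 * j ≤ a + b
  · rw [if_pos (show 2 ≤ a ∧ a ≤ j ∧ 2 * j + 1 ≤ a + (b + 1) by omega)]
    obtain ⟨d, rfl⟩ := Nat.exists_eq_add_of_le h.1
    rcases d with _ | d
    · rw [if_neg (by omega), if_pos (by omega), zero_add]
      simp
    · rw [if_pos (by omega)]
      simp only [show a + (d + 1) - (a + 1) = d by omega, show a + (d + 1) - a = d + 1 by omega]
      rcases Nat.lt_or_ge (a + b) (2 * (a + (d + 1)) + 1) with h' | h'
      · rw [if_neg (by omega), show b - (a + (d + 1)) - 1 = d by omega,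
          show b + 1 - (a + (d + 1)) - 1 = d + 1 by omega, Nat.choose_self, Nat.choose_self,
          pow_succ]
        module
      · rw [if_pos (by omega),
          show b + 1 - (a + (d + 1)) - 1 = (b - (a + (d + 1)) - 1) + 1 by omega,
          Nat.choose_succ_succ, pow_succ, Nat.cast_add]
        module
  · rw [if_neg (by omega), if_neg (by omega), if_neg (by omega), add_zero]

theorem isShiftDerivation_combination (x : ℕ → ℕ → K) : IsShiftDerivation (combination n x) :=
  isShiftDerivation_sum _ _ fun s _ => isShiftDerivation_sum _ _ fun j _ =>
    (isShiftDerivation_cocycle j s).smul _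

/-- The coefficient of `e_{a+b+s}` in `(∑ x_{j,s} Ψ_{j,s})(e_a, e_b)`. -/
def pairCoeff (x : ℕ → ℕ → K) (a b s : ℕ) : K :=
  ∑ l ∈ Icc a ((a + b - 1) / 2),
    (-1 : K) ^ (l - a) * ((b - l - 1).choose (l - a) : K) * x l s

theorem pairCoeff_succ (x : ℕ → ℕ → K) (a s : ℕ) : pairCoeff x a (a + 1) s = x a s := by
  rw [pairCoeff, show (a + (a + 1) - 1) / 2 = a by omega, Icc_self, sum_singleton]
  simp

/-- Only s = p - a - b reaches e_p. The ranges s ≤ n - 5 and j ≤ [(n-1)/2] discard nothing, since a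
+ b ≥ 5 and 2j + 1 ≤ a + b ≤ n for every contributing term. -/
theorem coord_combination (x : ℕ → ℕ → K) {a b : ℕ} (hab : a < b) (p : ℕ) :
    coord p (combination n x (e a) (e b)) =
      if 2 ≤ a ∧ a + b ≤ p ∧ p ≤ n then pairCoeff x a b (p - a - b) else 0 := by
  have key : ∀ s j, coord p ((x j s • cocycle K n j s) (e a) (e b)) =
      if (2 ≤ a ∧ a + b ≤ p ∧ p ≤ n) ∧ s = p - a - b then
        if a ≤ j ∧ 2 * j + 1 ≤ a + b then
          (-1 : K) ^ (j - a) * ((b - j - 1).choose (j - a) : K) * x j s else 0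
      else 0 := by
    intro s j
    rw [smul_apply_apply, map_smul, cocycle_e_e_of_lt j s hab]
    by_cases h : 2 ≤ a ∧ a ≤ j ∧ 2 * j + 1 ≤ a + b
    · rw [if_pos h, map_smul, coord_e, if_pos h.2]
      by_cases h' : (2 ≤ a ∧ a + b ≤ p ∧ p ≤ n) ∧ s = p - a - b
      · rw [if_pos h', if_pos (by omega), smul_eq_mul, smul_eq_mul, mul_one, mul_comm]
      · rw [if_neg h', if_neg (by omega), smul_zero, smul_zero]
    · rw [if_neg h, map_zero, smul_zero]
      split_ifs <;> first | rfl | (exfalso; tauto)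
  rw [combination, sum_cochain_apply, map_sum]
  simp only [sum_cochain_apply, map_sum, key]
  by_cases h : 2 ≤ a ∧ a + b ≤ p ∧ p ≤ n
  · rw [if_pos h, Finset.sum_eq_single (p - a - b)]
    · rw [Finset.sum_congr rfl fun j _ => if_pos (And.intro h rfl)]
      rw [pairCoeff, ← Finset.sum_filter]
      refine Finset.sum_congr (Finset.ext fun l => ?_) fun _ _ => rfl
      simp only [Finset.mem_filter, Finset.mem_Icc]
      omega
    · intro s _ hs
      exact Finset.sum_eq_zero fun j _ => if_neg (by tauto)
    · intro hs
      exact absurd (Finset.mem_range.2 (by omega)) hs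
  · rw [if_neg h]
    exact Finset.sum_eq_zero fun s _ => Finset.sum_eq_zero fun j _ => if_neg (by tauto)

theorem combination_e_e (x : ℕ → ℕ → K) {a b : ℕ} (ha : 2 ≤ a) (hab : a < b) :
    combination n x (e a) (e b) =
      -- The range is deliberately generous: the surplus terms have index above n and vanish, which
      -- avoids a bound depending on a and b.
      ∑ s ∈ range (n + 1), pairCoeff x a b s • (e (a + b + s) : M0 K n) := by
  refine ext_coord fun p hp => ?_
  rw [coord_combination x hab, map_sum]
  simp only [map_smul, coord_e, smul_eq_mul]
  by_cases h : a + b ≤ p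
  · rw [if_pos ⟨ha, h, hp.2⟩, Finset.sum_eq_single (p - a - b)]
    · rw [if_pos ⟨by omega, hp⟩, mul_one]
    · intro s _ hs
      rw [if_neg (by omega), mul_zero]
    · intro hs
      exact absurd (Finset.mem_range.2 (by have := hp.2; omega)) hs
  · rw [if_neg (by tauto)]
    exact (Finset.sum_eq_zero fun s _ => by rw [if_neg (by omega), mul_zero]).symm

theorem combination_e_one (x : ℕ → ℕ → K) {b : ℕ} (hb : 1 < b) :
    combination n x (e 1) (e b) = 0 :=
  ext_coord fun p _ => by rw [coord_combination x hb, if_neg (by omega), map_zero]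

/-- The coordinates of `Ψ(e_c, Ψ(e_a, e_b))` for `Ψ = ∑ x_{j,s} Ψ_{j,s}`. -/
theorem coord_combination_comp (x : ℕ → ℕ → K) {a b c : ℕ} (ha : 2 ≤ a) (hab : a < b)
    (hc : 2 ≤ c) (hcab : c < a + b) (p : ℕ) :
    coord p (combination n x (e c) (combination n x (e a) (e b))) =
      if a + b + c ≤ p ∧ p ≤ n then
        ∑ t ∈ Icc 0 (p - (a + b + c)),
          pairCoeff x a b t * pairCoeff x c (a + b + t) (p - (a + b + c) - t)
      else 0 := by
  rw [combination_e_e x ha hab, map_sum, map_sum]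
  have key : ∀ t, coord p (combination n x (e c) (pairCoeff x a b t • e (a + b + t))) =
      if (a + b + c ≤ p ∧ p ≤ n) ∧ t ≤ p - (a + b + c) then
        pairCoeff x a b t * pairCoeff x c (a + b + t) (p - (a + b + c) - t) else 0 := by
    intro t
    rw [map_smul, map_smul, coord_combination x (show c < a + b + t by omega), smul_eq_mul]
    by_cases h : (a + b + c ≤ p ∧ p ≤ n) ∧ t ≤ p - (a + b + c)
    · rw [if_pos h, if_pos (by omega),
        show p - c - (a + b + t) = p - (a + b + c) - t by omega]
    · rw [if_neg h, if_neg (by omega), mul_zero]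
  simp only [key]
  by_cases h : a + b + c ≤ p ∧ p ≤ n
  · simp only [h, true_and, and_self, if_true]
    rw [← Finset.sum_filter]
    refine Finset.sum_congr (Finset.ext fun t => ?_) fun _ _ => rfl
    simp only [Finset.mem_filter, Finset.mem_range, Finset.mem_Icc]
    omega
  · rw [if_neg h]
    exact Finset.sum_eq_zero fun t _ => if_neg (by tauto)

/-- Each outer product is turned so that its smaller index comes first: inner products only involve
indices at least the sum of their arguments, which exceeds the remaining index. The tables for
ordered pairs then apply. -/
theorem cyclicSquare_succ (Ψ : twoCochain K (M0 K n) (M0 K n)) (j q : ℕ) :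
    cyclicSquare Ψ (e j) (e q) (e (q + 1)) =
      -Ψ (e (q + 1)) (Ψ (e j) (e q)) - Ψ (e j) (Ψ (e q) (e (q + 1))) +
        Ψ (e q) (Ψ (e j) (e (q + 1))) := by
  rw [cyclicSquare, ← twoCochain_skew Ψ (e j) (e (q + 1)),
    ← twoCochain_skew Ψ _ (Ψ (e j) (e q)), ← twoCochain_skew Ψ _ (Ψ (e q) (e (q + 1))),
    ← twoCochain_skew Ψ _ (-Ψ (e j) (e (q + 1))), map_neg]
  abel

/-- The three sums defining F factor into the three double products of the cyclic square. In the
first, the exponent m - q stands where `pairCoeff` at q + 1 has m - (q + 1), which accounts for the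
minus sign. -/
theorem F_eq_sum_pairCoeff (x : ℕ → ℕ → K) {j q : ℕ} (hjq : j < q) (r : ℕ) :
    F x j q r = ∑ t ∈ Icc 0 r,
      (-(pairCoeff x j q t * pairCoeff x (q + 1) (j + q + t) (r - t)) -
        x q t * pairCoeff x j (2 * q + 1 + t) (r - t) +
        pairCoeff x j (q + 1) t * pairCoeff x q (j + q + 1 + t) (r - t)) := by
  have hsign : ∀ m, q + 1 ≤ m → (-1 : K) ^ (m - q) = -(-1) ^ (m - (q + 1)) := by
    intro m hm
    rw [show m - q = m - (q + 1) + 1 by omega, pow_succ]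
    ring
  rw [F, ← Finset.sum_add_distrib, ← Finset.sum_add_distrib]
  refine Finset.sum_congr rfl fun t _ => ?_
  have h1 : ∑ l ∈ Icc j ((j + q - 1) / 2), ∑ m ∈ Icc (q + 1) (q + (j + t) / 2),
      (-1 : K) ^ ((l - j) + (m - q)) * ((q - l - 1).choose (l - j) : K) *
        ((j + q + t - m - 1).choose (m - q - 1) : K) * x l t * x m (r - t) =
      -(pairCoeff x j q t * pairCoeff x (q + 1) (j + q + t) (r - t)) := by
    rw [pairCoeff, pairCoeff, Finset.sum_mul_sum, ← Finset.sum_neg_distrib,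
      show (q + 1 + (j + q + t) - 1) / 2 = q + (j + t) / 2 by omega]
    refine Finset.sum_congr rfl fun l _ => ?_
    rw [← Finset.sum_neg_distrib]
    refine Finset.sum_congr rfl fun m hm => ?_
    rw [pow_add, hsign m (Finset.mem_Icc.1 hm).1, Nat.sub_sub m q 1]
    ring
  have h2 : ∑ l ∈ Icc j ((j + q) / 2), ∑ m ∈ Icc q (q + (j + t) / 2),
      (-1 : K) ^ ((l - j) + (m - q)) * ((q - l).choose (l - j) : K) *
        ((j + q + t - m).choose (m - q) : K) * x l t * x m (r - t) =
      pairCoeff x j (q + 1) t * pairCoeff x q (j + q + 1 + t) (r - t) := by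
    rw [pairCoeff, pairCoeff, Finset.sum_mul_sum,
      show (j + (q + 1) - 1) / 2 = (j + q) / 2 by omega,
      show (q + (j + q + 1 + t) - 1) / 2 = q + (j + t) / 2 by omega]
    refine Finset.sum_congr rfl fun l _ => Finset.sum_congr rfl fun m _ => ?_
    rw [pow_add, show q + 1 - l - 1 = q - l by omega,
      show j + q + 1 + t - m - 1 = j + q + t - m by omega]
    ring
  have h3 : ∑ m ∈ Icc j (q + (j + t) / 2),
      (-1 : K) ^ ((m - j) + 1) * ((2 * q + t - m).choose (m - j) : K) * x q t * x m (r - t) =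
      -(x q t * pairCoeff x j (2 * q + 1 + t) (r - t)) := by
    rw [pairCoeff, Finset.mul_sum, ← Finset.sum_neg_distrib,
      show (j + (2 * q + 1 + t) - 1) / 2 = q + (j + t) / 2 by omega]
    refine Finset.sum_congr rfl fun m _ => ?_
    rw [pow_succ, show 2 * q + 1 + t - m - 1 = 2 * q + t - m by omega]
    ring
  rw [h1, h2, h3]
  ring

/-- The polynomials `F_{j,q,r}` are the coordinates of `½ [Ψ, Ψ](e_j, e_q, e_{q+1})`. -/
theorem coord_cyclicSquare_combination (x : ℕ → ℕ → K) {j q : ℕ} (hj : 2 ≤ j) (hjq : j < q)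
    (p : ℕ) :
    coord p (cyclicSquare (combination n x) (e j) (e q) (e (q + 1))) =
      if j + 2 * q + 1 ≤ p ∧ p ≤ n then F x j q (p - (j + 2 * q + 1)) else 0 := by
  rw [cyclicSquare_succ, map_add, map_sub, map_neg,
    coord_combination_comp x hj hjq (by omega) (by omega),
    coord_combination_comp x (by omega) (by omega) hj (by omega),
    coord_combination_comp x hj (by omega) (by omega) (by omega)]
  simp only [show j + q + (q + 1) = j + 2 * q + 1 by omega,
    show q + (q + 1) + j = j + 2 * q + 1 by omega,
    show j + (q + 1) + q = j + 2 * q + 1 by omega]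
  split_ifs with h
  · rw [F_eq_sum_pairCoeff x hjq, Finset.sum_add_distrib, Finset.sum_sub_distrib,
      Finset.sum_neg_distrib]
    simp only [pairCoeff_succ, show q + (q + 1) = 2 * q + 1 by omega,
      show j + (q + 1) = j + q + 1 by omega]
  · simp

end Tables

/-! ### The contribution of Ψ_{k,-1} and the polynomials G. -/

section EvenCase

variable {K : Type*} [Field K] {k : ℕ}

theorem cocycleNegOne_e_e_of_lt {a b : ℕ} (ha : 1 ≤ a) (hab : a < b) :
    cocycleNegOne K k (e a) (e b) =
      if 2 ≤ a ∧ a + b = 2 * k + 1 then (-1 : K) ^ (k - a) • (e (2 * k) : M0 K (2 * k))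
      else 0 := by
  rcases le_or_gt b (2 * k) with hb | hb
  · exact cocycleNegOne_e_e k a b ha hab hb
  · rw [e_eq_zero hb, map_zero, if_neg (by omega)]

/-- The image lies in the line of e_{2k}, which `shift` kills, and for a + b = 2k the two left-hand
terms have consecutive, hence opposite, signs. -/
theorem isShiftDerivation_cocycleNegOne : IsShiftDerivation (cocycleNegOne K k) := by
  refine isShiftDerivation_of_basis (fun b hb => ?_) (fun a b ha hab => ?_)
  · rw [cocycleNegOne_e_e_of_lt le_rfl hb, if_neg (by omega)]
  have hr : shift (cocycleNegOne K k (e a) (e b)) = 0 := by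
    rw [cocycleNegOne_e_e_of_lt (by omega) hab]
    split_ifs
    · rw [map_smul, shift_e_of_two_le (by omega), e_eq_zero (by omega), smul_zero]
    · exact map_zero _
  rw [hr, cocycleNegOne_e_e_of_lt (by omega) (show a < b + 1 by omega)]
  -- When b = a + 1 the sum a + b is odd, so the remaining term is off the line a + b = 2k and
  -- vanishes too.
  rcases eq_or_lt_of_le (show a + 1 ≤ b from hab) with rfl | hab'
  · rw [twoCochain_alt, if_neg (by omega), add_zero]
  rw [cocycleNegOne_e_e_of_lt (by omega) hab']
  by_cases h : a + b = 2 * k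
  · rw [if_pos (by omega), if_pos (by omega), show k - a = k - (a + 1) + 1 by omega, pow_succ]
    module
  · rw [if_neg (by omega), if_neg (by omega), add_zero]

/-- The inner value is a multiple of e_{2k}, and multiplying by e_c would land in index at least c +
2k > 2k. -/
theorem combination_cocycleNegOne (x : ℕ → ℕ → K) {a b c : ℕ} (ha : 1 ≤ a) (hab : a < b)
    (hc : 2 ≤ c) : combination (2 * k) x (e c) (cocycleNegOne K k (e a) (e b)) = 0 := by
  rw [cocycleNegOne_e_e_of_lt ha hab]
  split_ifs
  · rw [map_smul]
    suffices h : combination (2 * k) x (e c) (e (2 * k)) = 0 by rw [h, smul_zero]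
    rcases lt_trichotomy c (2 * k) with h | rfl | h
    · exact ext_coord fun p _ => by rw [coord_combination x h, if_neg (by omega), map_zero]
    · exact twoCochain_alt _ _
    · rw [e_eq_zero h, map_zero, LinearMap.zero_apply]
  · exact map_zero _

theorem cocycleNegOne_cocycleNegOne {a b c : ℕ} (ha : 1 ≤ a) (hab : a < b)
    (hc : 2 ≤ c) : cocycleNegOne K k (e c) (cocycleNegOne K k (e a) (e b)) = 0 := by
  rw [cocycleNegOne_e_e_of_lt ha hab]
  split_ifs
  · rw [map_smul]
    suffices h : cocycleNegOne K k (e c) (e (2 * k)) = 0 by rw [h, smul_zero]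
    rcases lt_trichotomy c (2 * k) with h | rfl | h
    · rw [cocycleNegOne_e_e_of_lt (by omega) h, if_neg (by omega)]
    · exact twoCochain_alt _ _
    · rw [e_eq_zero h, map_zero, LinearMap.zero_apply]
  · exact map_zero _

/-- The coordinates of `Ψ_{k,-1}(e_c, Ψ(e_a, e_b))` for `Ψ = ∑ x_{j,s} Ψ_{j,s}`. -/
theorem coord_cocycleNegOne_comp (x : ℕ → ℕ → K) {a b c : ℕ} (ha : 2 ≤ a) (hab : a < b)
    (hc : 2 ≤ c) (hcab : c < a + b) {p : ℕ} (hp : 1 ≤ p) :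
    coord p (cocycleNegOne K k (e c) (combination (2 * k) x (e a) (e b))) =
      if p = 2 * k ∧ a + b + c ≤ 2 * k + 1 then
        pairCoeff x a b (2 * k + 1 - (a + b + c)) * (-1) ^ (k - c)
      else 0 := by
  rw [combination_e_e x ha hab, map_sum, map_sum]
  have key : ∀ t, coord p (cocycleNegOne K k (e c) (pairCoeff x a b t • e (a + b + t))) =
      if (p = 2 * k ∧ a + b + c ≤ 2 * k + 1) ∧ t = 2 * k + 1 - (a + b + c) then
        pairCoeff x a b t * (-1) ^ (k - c) else 0 := by
    intro t
    rw [map_smul, map_smul, cocycleNegOne_e_e_of_lt (by omega) (show c < a + b + t by omega),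
      smul_eq_mul]
    by_cases h : a + b + c ≤ 2 * k + 1 ∧ t = 2 * k + 1 - (a + b + c)
    · rw [if_pos (by omega), map_smul, coord_e]
      by_cases h' : p = 2 * k
      · rw [if_pos (by omega), if_pos (by omega), smul_eq_mul, mul_one]
      · rw [if_neg (by omega), if_neg (by omega), smul_zero, mul_zero]
    · rw [if_neg (by omega), if_neg (by omega), map_zero, mul_zero]
  simp only [key]
  by_cases h : p = 2 * k ∧ a + b + c ≤ 2 * k + 1
  · rw [if_pos h, Finset.sum_eq_single (2 * k + 1 - (a + b + c))]
    · rw [if_pos ⟨h, rfl⟩]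
    · intro t _ ht
      exact if_neg (by tauto)
    · intro ht
      exact absurd (Finset.mem_range.2 (by omega)) ht
  · rw [if_neg h]
    exact Finset.sum_eq_zero fun t _ => if_neg (by tauto)

theorem neg_one_pow_sub {a b : ℕ} (h : a ≤ b) : (-1 : K) ^ (b - a) = (-1) ^ b * (-1) ^ a := by
  obtain ⟨d, rfl⟩ := Nat.exists_eq_add_of_le h
  rw [Nat.add_sub_cancel_left, pow_add, mul_right_comm, ← pow_add, Even.neg_one_pow ⟨a, rfl⟩,
    one_mul]

/-- The exponent k - j - q can be negative, hence the integer power; only its parity matters. -/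
theorem neg_one_zpow_sub_sub (k j q : ℕ) :
    (-1 : K) ^ ((k : ℤ) - j - q) = (-1) ^ k * (-1) ^ j * (-1) ^ q := by
  have h : (-1 : K) ≠ 0 := neg_ne_zero.2 one_ne_zero
  have hinv : ∀ m : ℕ, ((-1 : K) ^ m)⁻¹ = (-1) ^ m := fun m => by
    rw [← inv_pow, inv_neg, inv_one]
  rw [zpow_sub₀ h, zpow_sub₀ h, zpow_natCast, zpow_natCast, zpow_natCast, div_eq_mul_inv,
    div_eq_mul_inv, hinv, hinv]

theorem G_eq_pairCoeff (x : ℕ → ℕ → K) (j q : ℕ) (r : ℤ) :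
    G x j q r = (-1) ^ j * pairCoeff x j q (r + 1).toNat +
      (-1) ^ j * pairCoeff x j (q + 1) (r + 1).toNat - (-1) ^ q * x q (r + 1).toNat := by
  have hsign : ∀ l, j ≤ l → (-1 : K) ^ l = (-1) ^ j * (-1) ^ (l - j) := fun l hl => by
    rw [← pow_add, Nat.add_sub_cancel' hl]
  rw [G, pairCoeff, pairCoeff, Finset.mul_sum, Finset.mul_sum,
    show (j + (q + 1) - 1) / 2 = (j + q) / 2 by omega]
  congr 2
  · refine Finset.sum_congr rfl fun l hl => ?_
    rw [hsign l (Finset.mem_Icc.1 hl).1]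
    ring
  · refine Finset.sum_congr rfl fun l hl => ?_
    rw [hsign l (Finset.mem_Icc.1 hl).1, show q + 1 - l - 1 = q - l by omega]
    ring

/-- The coordinates of `½ [Ψ, Ψ](e_j, e_q, e_{q+1})` for `Ψ = c Ψ_{k,-1} + ∑ x_{j,s} Ψ_{j,s}`. -/
theorem coord_cyclicSquare_add (c : K) (x : ℕ → ℕ → K) {j q : ℕ} (hj : 2 ≤ j) (hjq : j < q)
    {p : ℕ} (hp : 1 ≤ p) :
    coord p (cyclicSquare (c • cocycleNegOne K k + combination (2 * k) x)
        (e j) (e q) (e (q + 1))) =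
      (if j + 2 * q + 1 ≤ p ∧ p ≤ 2 * k then F x j q (p - (j + 2 * q + 1)) else 0) +
        if p = 2 * k ∧ j + 2 * q ≤ 2 * k then
          (-1 : K) ^ ((k : ℤ) - j - q) * c * G x j q (((2 * k - (j + 2 * q) : ℕ) : ℤ) - 1)
        else 0 := by
  have hsplit : cyclicSquare (c • cocycleNegOne K k + combination (2 * k) x)
        (e j) (e q) (e (q + 1)) =
      -- No c² term and no term with Ψ_{k,-1} inside appear: both are iterated products passing
      -- through e_{2k}.
      cyclicSquare (combination (2 * k) x) (e j) (e q) (e (q + 1)) +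
      c • (-cocycleNegOne K k (e (q + 1)) (combination (2 * k) x (e j) (e q)) -
        cocycleNegOne K k (e j) (combination (2 * k) x (e q) (e (q + 1))) +
        cocycleNegOne K k (e q) (combination (2 * k) x (e j) (e (q + 1)))) := by
    simp only [cyclicSquare_succ, add_apply_apply, smul_apply_apply, map_add, map_smul]
    rw [combination_cocycleNegOne x (by omega) hjq (by omega),
      combination_cocycleNegOne x (by omega) (by omega) hj,
      combination_cocycleNegOne x (by omega) (show j < q + 1 by omega) (by omega),
      cocycleNegOne_cocycleNegOne (by omega) hjq (by omega),
      cocycleNegOne_cocycleNegOne (by omega) (by omega) hj,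
      cocycleNegOne_cocycleNegOne (by omega) (show j < q + 1 by omega) (by omega)]
    module
  rw [hsplit, map_add, coord_cyclicSquare_combination x hj hjq, map_smul, map_add, map_sub,
    map_neg, coord_cocycleNegOne_comp x hj hjq (by omega) (by omega) hp,
    coord_cocycleNegOne_comp x (by omega) (by omega) hj (by omega) hp,
    coord_cocycleNegOne_comp x hj (by omega) (by omega) (by omega) hp]
  simp only [show j + q + (q + 1) = j + 2 * q + 1 by omega,
    show q + (q + 1) + j = j + 2 * q + 1 by omega,
    show j + (q + 1) + q = j + 2 * q + 1 by omega, Nat.add_le_add_iff_right]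
  congr 1
  split_ifs with h
  · rw [G_eq_pairCoeff, pairCoeff_succ, neg_one_zpow_sub_sub, sub_add_cancel, Int.toNat_natCast,
      show 2 * k + 1 - (j + 2 * q + 1) = 2 * k - (j + 2 * q) by omega,
      neg_one_pow_sub (show q + 1 ≤ k by omega), neg_one_pow_sub (show j ≤ k by omega),
      neg_one_pow_sub (show q ≤ k by omega), pow_succ, smul_eq_mul]
    have hsq : ∀ m : ℕ, (-1 : K) ^ m * (-1) ^ m = 1 := fun m => by
      rw [← pow_add, Even.neg_one_pow ⟨m, rfl⟩]
    -- The prefactor contains (-1)^j and (-1)^q, which square away against the same signs in G: the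
    -- former on the two `pairCoeff` terms, the latter on x_q.
    linear_combination (-1) * ((-1) ^ k * (-1) ^ q * c * (pairCoeff x j q (2 * k - (j + 2 * q)) +
      pairCoeff x j (q + 1) (2 * k - (j + 2 * q)))) * hsq j +
      (-1) ^ k * (-1) ^ j * c * x q (2 * k - (j + 2 * q)) * hsq q
  · simp

end EvenCase

/-! ### Matching coordinates with the stated equations. -/

section Main

variable {K : Type*} [Field K]

theorem deformationEquation_iff_coord {n : ℕ} (h2 : (2 : K) ≠ 0)
    {Ψ : twoCochain K (M0 K n) (M0 K n)} (hD : IsShiftDerivation Ψ)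
    (hΨ : ∀ a b, 1 ≤ a → a < b → coord 1 (Ψ (e a) (e b)) = 0)
    (h1 : ∀ b, 1 < b → Ψ (e 1) (e b) = 0) :
    DeformationEquation Ψ ↔ ∀ j q, 2 ≤ j → j < q → ∀ p, 1 ≤ p → p ≤ n →
      coord p (cyclicSquare Ψ (e j) (e q) (e (q + 1))) = 0 := by
  rw [deformationEquation_iff_cyclicSquare h2 hD (coord_one_apply_eq_zero hΨ),
    hD.cyclicSquare_eq_zero_iff (apply_e_one_eq_zero h1)]
  refine forall₄_congr fun j q _ _ => ⟨fun h p _ _ => by rw [h, map_zero], fun h => ?_⟩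
  exact ext_coord fun p hp => by rw [h p hp.1 hp.2, map_zero]

theorem deformationEquation_combination_iff (h2 : (2 : K) ≠ 0) (n : ℕ) (x : ℕ → ℕ → K) :
    DeformationEquation (combination n x) ↔
      ∀ j q r, 2 ≤ j → j < q → j + 2 * q + 1 + r ≤ n → F x j q r = 0 := by
  rw [deformationEquation_iff_coord h2 (isShiftDerivation_combination x)
    (fun a b _ hab => by rw [coord_combination x hab, if_neg (by omega)])
    (fun b hb => combination_e_one x hb)]
  constructor
  · intro h j q r hj hjq hr
    have := h j q hj hjq (j + 2 * q + 1 + r) (by omega) hr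
    rwa [coord_cyclicSquare_combination x hj hjq, if_pos (by omega),
      Nat.add_sub_cancel_left] at this
  · intro h j q hj hjq p _ _
    rw [coord_cyclicSquare_combination x hj hjq]
    split_ifs with hp
    · exact h j q _ hj hjq (by omega)
    · rfl

theorem deformationEquation_add_combination_iff (h2 : (2 : K) ≠ 0) {k : ℕ} (hk : 1 ≤ k) (c : K)
    (x : ℕ → ℕ → K) :
    DeformationEquation (c • cocycleNegOne K k + combination (2 * k) x) ↔
      (∀ j q r, 2 ≤ j → j < q → j + 2 * q + 1 + r < 2 * k → F x j q r = 0) ∧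
      (∀ j q r : ℕ, 2 ≤ j → j < q → j + 2 * q + 1 + r = 2 * k →
        F x j q r + (-1 : K) ^ ((k : ℤ) - j - q) * c * G x j q (r : ℤ) = 0) ∧
      (∀ j q, 2 ≤ j → j < q → j + 2 * q = 2 * k → c * G x j q (-1) = 0) := by
  rw [deformationEquation_iff_coord h2
    ((isShiftDerivation_cocycleNegOne.smul c).add (isShiftDerivation_combination x))]
  · constructor
    · intro h
      refine ⟨fun j q r hj hjq hr => ?_, fun j q r hj hjq hr => ?_, fun j q hj hjq hr => ?_⟩
      · have := h j q hj hjq (j + 2 * q + 1 + r) (by omega) (by omega)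
        rwa [coord_cyclicSquare_add c x hj hjq (by omega), if_pos (by omega), if_neg (by omega),
          Nat.add_sub_cancel_left, add_zero] at this
      · have := h j q hj hjq (2 * k) (by omega) (by omega)
        rwa [coord_cyclicSquare_add c x hj hjq (by omega), if_pos (by omega), if_pos (by omega),
          show 2 * k - (j + 2 * q + 1) = r by omega, show 2 * k - (j + 2 * q) = r + 1 by omega,
          Nat.cast_add, Nat.cast_one, add_sub_cancel_right] at this
      · have := h j q hj hjq (2 * k) (by omega) (by omega)
        rw [coord_cyclicSquare_add c x hj hjq (by omega), if_neg (by omega), if_pos (by omega),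
          show 2 * k - (j + 2 * q) = 0 by omega, Nat.cast_zero, zero_sub, zero_add,
          mul_assoc] at this
        -- For r = -1 there is no F-term, so the unit sign in front of G can be dropped.
        exact (mul_eq_zero.1 this).resolve_left (zpow_ne_zero _ (neg_ne_zero.2 one_ne_zero))
    · rintro ⟨hF, hFG, hG⟩ j q hj hjq p hp hpk
      rw [coord_cyclicSquare_add c x hj hjq hp]
      -- Below index j + 2q + 1 only G can contribute, and then p = 2k = j + 2q, the case r = -1.
      -- Above, p = 2k gives the mixed equation and p < 2k the pure F-equation.
      rcases Nat.lt_or_ge p (j + 2 * q + 1) with h | h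
      · rw [if_neg (by omega), zero_add]
        split_ifs with h'
        · rw [show 2 * k - (j + 2 * q) = 0 by omega, Nat.cast_zero, zero_sub, mul_assoc,
            hG j q hj hjq (by omega), mul_zero]
        · rfl
      · obtain ⟨r, rfl⟩ := Nat.exists_eq_add_of_le h
        rw [if_pos ⟨h, hpk⟩, Nat.add_sub_cancel_left]
        rcases eq_or_lt_of_le hpk with h' | h'
        · rw [if_pos (by omega), show 2 * k - (j + 2 * q) = r + 1 by omega,
            Nat.cast_add, Nat.cast_one, add_sub_cancel_right]
          exact hFG j q r hj hjq h'
        · rw [if_neg (by omega), add_zero]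
          exact hF j q r hj hjq h'
  · intro a b ha hab
    rw [add_apply_apply, smul_apply_apply, map_add, map_smul, coord_combination x hab,
      cocycleNegOne_e_e_of_lt ha hab, if_neg (show ¬ (2 ≤ a ∧ a + b ≤ 1 ∧ 1 ≤ 2 * k) by omega)]
    split_ifs
    · rw [map_smul, coord_e, if_neg (by omega), smul_zero, smul_zero, add_zero]
    · rw [map_zero, smul_zero, add_zero]
  · intro b hb
    rw [add_apply_apply, smul_apply_apply, combination_e_one x hb,
      cocycleNegOne_e_e_of_lt le_rfl hb, if_neg (by omega), smul_zero, add_zero]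

end Main

end Filiform

theorem mainTheorem2 {K : Type*} [Field K] (hK : (2 : K) ≠ 0) :
    (∀ n k : ℕ, n = 2 * k + 1 → 9 ≤ n → ∀ x : ℕ → ℕ → K,
      (Filiform.DeformationEquation (Filiform.combination n x) ↔
        ∀ j q r : ℕ, 2 ≤ j → j < q → 9 ≤ j + 2 * q + 1 + r → j + 2 * q + 1 + r ≤ n →
          Filiform.F x j q r = 0)) ∧
    (∀ k : ℕ, 10 ≤ 2 * k → ∀ c : K, (c = 0 ∨ c = 1) → ∀ x : ℕ → ℕ → K,
      (Filiform.DeformationEquation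
          (c • Filiform.cocycleNegOne K k + Filiform.combination (2 * k) x) ↔
        (∀ j q r : ℕ, 2 ≤ j → j < q → 9 ≤ j + 2 * q + 1 + r → j + 2 * q + 1 + r < 2 * k →
          Filiform.F x j q r = 0) ∧
        (∀ j q r : ℕ, 2 ≤ j → j < q → j + 2 * q + 1 + r = 2 * k →
          Filiform.F x j q r +
            (-1 : K) ^ ((k : ℤ) - j - q) * c * Filiform.G x j q (r : ℤ) = 0) ∧
        (∀ j q : ℕ, 2 ≤ j → j < q → j + 2 * q = 2 * k →
          c * Filiform.G x j q (-1) = 0))) := by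

  refine ⟨fun n k _ _ x => ?_, fun k hk c _ x => ?_⟩
  · rw [Filiform.deformationEquation_combination_iff hK]
    -- The bound 9 ≤ j + 2q + 1 + r is automatic from j ≥ 2 and q ≥ 3.
    exact forall₅_congr fun j q r hj hjq => ⟨fun h _ => h, fun h => h (by omega)⟩
  · rw [Filiform.deformationEquation_add_combination_iff hK (by omega)]
    refine and_congr (forall₅_congr fun j q r hj hjq => ?_) Iff.rfl
    exact ⟨fun h _ => h, fun h => h (by omega)⟩
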